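/- Let $F$ be a division ring, $n$ a natural number, $\sigma\colon F\to F^{n\times n}$ a ring morphism and $\delta\colon F\to F^n$ a $\sigma$-derivation, i.e. an additive map with $\delta(xy)=\sigma(x)\delta(y)+\delta(x)y$. Let $F[\mathbf x;\sigma,\delta]$ be the free multivariate skew polynomial ring: it has the words (monomials) in $x_1,\dots,x_n$ as a left $F$-basis, words are multiplied by appending, and $x_i c=\sum_j\sigma_{i,j}(c)x_j+\delta_i(c)$ for $c\in F$; the degree of a skew polynomial is the maximal length of a word that occurs in it ($\deg 0=-\infty$). For $P\in F[\mathbf x;\sigma,\delta]$ and $\mathbf a\in F^n$, the evaluation $P(\mathbf a)$ is the unique element of $F$ such that $P-P(\mathbf a)$ lies in the left ideal $(x_1-a_1,\dots,x_n-a_n)$. The P-closure $\overline\Omega$ of $\Omega\subseteq F^n$ is the set of common zeros of all skew polynomials that vanish on $\Omega$; $\Omega$ is P-closed if $\overline\Omega=\Omega$, and P-independent if $\mathbf a\notin\overline{\Omega\setminus\{\mathbf a\}}$ for all $\mathbf a\in\Omega$. A P-basis of a P-closed set $\Omega$ is a P-independent subset of $\Omega$ with P-closure $\Omega$; the rank $\mathrm{Rk}(\Omega)$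 is the common size of the finite P-bases of $\Omega$, if there are any. For a finite P-independent set $\mathcal B\subseteq F^n$ with $M$ elements, put $\Omega=\overline{\mathcal B}$. For a skew polynomial $P$ with $\deg P<M$ let $Z_\Omega(P)$ be the set of zeros of $P$ in $\Omega$, and $\mathrm{wt}^{\sigma,\delta}_\Omega(P)=\mathrm{Rk}(\Omega)-\mathrm{Rk}(Z_\Omega(P))$. The skew weight of $f\in F^{\mathcal B}$ is $\mathrm{wt}^{\sigma,\delta}_{\mathcal B}(f)=\mathrm{wt}^{\sigma,\delta}_\Omega(P)$ for any skew polynomial $P$ with $\deg P<M$ and $P(\mathbf b)=f(\mathbf b)$ for all $\mathbf b\in\mathcal B$. For $\mathbf a\in F^n$ and $\beta\in F$ let $\mathcal D_{\mathbf a}(\beta)=\sigma(\beta)\mathbf a+\delta(\beta)\in F^n$; the conjugate of $\mathbf a$ with exponent $\beta\neq0$ is $\mathbf a^\beta=\mathcal D_{\mathbf a}(\beta)\beta^{-1}$, and the centralizer $K_{\mathbf a}=\{\beta\in F\mid\mathcal D_{\mathbf a}(\beta)=\mathbf a\beta\}$ is a division subring of $F$. For words $\mathfrak m$ let $\mathcal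 D_{\mathbf a}^{1}=\mathrm{id}$ and let $\mathcal D_{\mathbf a}^{x_i\mathfrak m}(\beta)$ be the $i$-th entry of $\mathcal D_{\mathbf a}(\mathcal D_{\mathbf a}^{\mathfrak m}(\beta))$; for $P=\sum_{\mathfrak m}P_{\mathfrak m}\mathfrak m$ put $P^{\mathcal D_{\mathbf a}}(\beta)=\sum_{\mathfrak m}P_{\mathfrak m}\mathcal D_{\mathbf a}^{\mathfrak m}(\beta)$. For division subrings $K_1,\dots,K_\ell$ of $F$, lengths $M_1,\dots,M_\ell$ and $M=M_1+\dots+M_\ell$, the sum-rank weight of $\mathbf c=(c^{(i)}_j)\in F^M$ is $\mathrm{wt}_{SR}(\mathbf c)=\sum_{i=1}^\ell\dim_{K_i}\langle c^{(i)}_1,\dots,c^{(i)}_{M_i}\rangle^R_{K_i}$, where $\langle\cdot\rangle^R_{K_i}$ denotes the right $K_i$-linear span. **Theorem.** Let $\mathbf a_1,\dots,\mathbf a_\ell\in F^n$ be pairwise non-conjugate, let $\beta^{(i)}_j\in F\setminus\{0\}$ for $1\le j\le M_i$, $1\le i\le\ell$, and put $\mathbf b^{(i)}_j=\mathbf a_i^{\beta^{(i)}_j}$.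 Suppose that the $M=M_1+\dots+M_\ell$ points $\mathbf b^{(i)}_j$ are distinct and that $\mathcal B=\{\mathbf b^{(i)}_j\}$ is P-independent, hence a P-basis of $\Omega=\overline{\mathcal B}$. Let $\mathrm{wt}_{SR}$ be the sum-rank weight with lengths $(M_1,\dots,M_\ell)$ and division subrings $(K_{\mathbf a_1},\dots,K_{\mathbf a_\ell})$. Then: 1. For every $f\in F^{\mathcal B}$, the skew weight $\mathrm{wt}^{\sigma,\delta}_{\mathcal B}(f)$ is well defined (there is a $P$ of degree less than $M$ with values $f$ on $\mathcal B$, and for all such $P$ the set $Z_\Omega(P)$ has a finite P-basis and $\mathrm{wt}^{\sigma,\delta}_\Omega(P)$ is the same number), and $$\mathrm{wt}^{\sigma,\delta}_{\mathcal B}(f)=\mathrm{wt}_{SR}(\mathbf c),\qquad\text{where } c^{(i)}_j=f(\mathbf b^{(i)}_j)\,\beta^{(i)}_j .$$ 2. For every $d\ge0$, the same scaling $(c^{(i)}_j)\mapsto(c^{(i)}_j\beta^{(i)}_j)$ of $F^M$ maps the skew Reed–Muller code $\{(P(\mathbf b^{(i)}_j))_{i,j}\mid\deg P<d\}$ onto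 the linearized Reed–Muller code $\{(P^{\mathcal D_{\mathbf a_i}}(\beta^{(i)}_j))_{i,j}\mid\deg P<d\}$. -/

import Mathlib

/-- A `σ`-derivation `δ : F → Fⁿ` for a ring morphism `σ : F → F^{n × n}`: an additive map with
`δ (a b) = σ(a) δ(b) + δ(a) b`. -/
structure SkewDerivation {F : Type*} [DivisionRing F] {n : ℕ}
    (σ : F →+* Matrix (Fin n) (Fin n) F) extends F →+ (Fin n → F) where
  leibniz' : ∀ x y : F, toFun (x * y) = Matrix.mulVec (σ x) (toFun y) + fun i => toFun x i * y

/-- The underlying left vector space of the free multivariate skew polynomial ring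
`F[x; σ, δ]`: it has the monomials (words in the letters `x₁, …, xₙ`) as a left basis. -/
def SkewPoly {F : Type*} [DivisionRing F] {n : ℕ}
    (σ : F →+* Matrix (Fin n) (Fin n) F) (_δ : SkewDerivation σ) : Type _ :=
  FreeMonoid (Fin n) →₀ F

namespace SkewPoly

section Ring

variable {F : Type*} [DivisionRing F] {n : ℕ}
  {σ : F →+* Matrix (Fin n) (Fin n) F} {δ : SkewDerivation σ}

noncomputable instance instAddCommGroup : AddCommGroup (SkewPoly σ δ) :=
  inferInstanceAs (AddCommGroup (FreeMonoid (Fin n) →₀ F))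

noncomputable instance instModule : Module F (SkewPoly σ δ) :=
  inferInstanceAs (Module F (FreeMonoid (Fin n) →₀ F))

/-- The coefficient of the monomial `m`. -/
def coeff (P : SkewPoly σ δ) (m : FreeMonoid (Fin n)) : F :=
  (show FreeMonoid (Fin n) →₀ F from P) m

/-- The monomials that occur in `P` (those with a non-zero coefficient). -/
def support (P : SkewPoly σ δ) : Finset (FreeMonoid (Fin n)) :=
  Finsupp.support (show FreeMonoid (Fin n) →₀ F from P)

/-- The skew polynomial `c m` for a constant `c` and a monomial `m`, additively in `c`. -/
noncomputable def monomial (m : FreeMonoid (Fin n)) : F →+ SkewPoly σ δ :=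
  Finsupp.singleAddHom m

/-- Left linear extension of a map on monomials. -/
noncomputable def lsum {V : Type*} [AddCommGroup V] [Module F V] (P : SkewPoly σ δ)
    (g : FreeMonoid (Fin n) → V) : V :=
  P.support.sum fun m => P.coeff m • g m

/-- The degree of `P`: the maximal length of a monomial of `P`, and `⊥` (i.e. `-∞`) for `P = 0`. -/
def degree (P : SkewPoly σ δ) : WithBot ℕ :=
  P.support.sup fun m => ((FreeMonoid.length m : ℕ) : WithBot ℕ)

theorem hom_ext {V : Type*} [AddCommGroup V] {f g : SkewPoly σ δ →+ V}
    (h : ∀ m c, f (monomial m c) = g (monomial m c)) : f = g :=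
  Finsupp.addHom_ext h

theorem smul_monomial (c : F) (m : FreeMonoid (Fin n)) (d : F) :
    c • (monomial m d : SkewPoly σ δ) = monomial m (c * d) :=
  Finsupp.smul_single c m d

theorem lsum_monomial {V : Type*} [AddCommGroup V] [Module F V] (m : FreeMonoid (Fin n)) (c : F)
    (g : FreeMonoid (Fin n) → V) : lsum (monomial m c : SkewPoly σ δ) g = c • g m :=
  Finsupp.sum_single_index (h := fun m c => c • g m) (zero_smul F (g m))

theorem lsum_add {V : Type*} [AddCommGroup V] [Module F V] (P Q : SkewPoly σ δ)
    (g : FreeMonoid (Fin n) → V) : lsum (P + Q) g = lsum P g + lsum Q g :=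
  Finsupp.sum_add_index' (h := fun m c => c • g m) (fun m => zero_smul F (g m))
    (fun m _ _ => add_smul _ _ (g m))

theorem lsum_smul {V : Type*} [AddCommGroup V] [Module F V] (c : F) (P : SkewPoly σ δ)
    (g : FreeMonoid (Fin n) → V) : lsum (c • P) g = c • lsum P g := by
  refine (Finsupp.sum_smul_index (h := fun m c => c • g m) (fun m => zero_smul F (g m))).trans ?_
  simp only [mul_smul]
  exact (Finset.smul_sum).symm

theorem lsum_one (P : SkewPoly σ δ) : lsum P (fun m => (monomial m 1 : SkewPoly σ δ)) = P := by
  simp only [lsum, smul_monomial, mul_one]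
  exact Finsupp.sum_single (show FreeMonoid (Fin n) →₀ F from P)

/-- `lsum` as a left linear map. -/
noncomputable def lsumHom {V : Type*} [AddCommGroup V] [Module F V]
    (g : FreeMonoid (Fin n) → V) : SkewPoly σ δ →ₗ[F] V where
  toFun P := lsum P g
  map_add' P Q := lsum_add P Q g
  map_smul' c P := lsum_smul c P g

/-- Left multiplication by the variable `xᵢ`, as forced by the rule
`xᵢ c = ∑ⱼ σᵢⱼ(c) xⱼ + δᵢ(c)` and by appending of monomials:
`xᵢ (c m) = ∑ⱼ σᵢⱼ(c) (xⱼ m) + δᵢ(c) m`. -/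
noncomputable def varOp (i : Fin n) : SkewPoly σ δ →+ SkewPoly σ δ :=
  Finsupp.liftAddHom fun m =>
    ((Finset.univ.sum fun j => (monomial (FreeMonoid.of j * m)).comp
        (((Pi.evalAddMonoidHom (fun _ : Fin n => F) j).comp
          (Pi.evalAddMonoidHom (fun _ : Fin n => Fin n → F) i)).comp
            (σ : F →+ Matrix (Fin n) (Fin n) F))) +
      (monomial m).comp ((Pi.evalAddMonoidHom (fun _ : Fin n => F) i).comp δ.toAddMonoidHom) :
      F →+ SkewPoly σ δ)

theorem varOp_monomial (i : Fin n) (m : FreeMonoid (Fin n)) (c : F) :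
    varOp i (monomial m c : SkewPoly σ δ) =
      (∑ j, monomial (FreeMonoid.of j * m) (σ c i j)) + monomial m (δ.toAddMonoidHom c i) := by
  refine (Finsupp.liftAddHom_apply_single _ m c).trans ?_
  simp only [AddMonoidHom.add_apply, AddMonoidHom.finsetSum_apply]
  rfl

/-- Left multiplication by a monomial. -/
noncomputable def wordOp : FreeMonoid (Fin n) →* AddMonoid.End (SkewPoly σ δ) :=
  FreeMonoid.lift varOp

/-- The product of the free skew polynomial ring: `(∑ₘ Pₘ m) Q = ∑ₘ Pₘ (m Q)`. -/
noncomputable instance instMul : Mul (SkewPoly σ δ) :=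
  ⟨fun P Q => lsum P fun m => wordOp m Q⟩

noncomputable instance instOne : One (SkewPoly σ δ) := ⟨monomial 1 1⟩

theorem mul_def (P Q : SkewPoly σ δ) : P * Q = lsum P fun m => wordOp m Q := rfl

theorem one_def : (1 : SkewPoly σ δ) = monomial 1 1 := rfl

theorem derivation_mul (x y : F) (i : Fin n) : δ.toAddMonoidHom (x * y) i =
    (∑ j, σ x i j * δ.toAddMonoidHom y j) + δ.toAddMonoidHom x i * y :=
  congrFun (δ.leibniz' x y) i

theorem derivation_one : δ.toAddMonoidHom 1 = 0 := by
  funext i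
  have h := derivation_mul (δ := δ) 1 1 i
  simpa [Matrix.one_apply] using h

theorem varOp_smul (i : Fin n) (c : F) (Q : SkewPoly σ δ) :
    varOp i (c • Q) = (∑ j, σ c i j • varOp j Q) + δ.toAddMonoidHom c i • Q := by
  have key : (varOp i).comp (DistribSMul.toAddMonoidHom (SkewPoly σ δ) c) =
      (∑ j, (DistribSMul.toAddMonoidHom (SkewPoly σ δ) (σ c i j)).comp (varOp j)) +
        DistribSMul.toAddMonoidHom (SkewPoly σ δ) (δ.toAddMonoidHom c i) := by
    refine hom_ext fun m d => ?_
    simp only [AddMonoidHom.comp_apply, DistribSMul.toAddMonoidHom_apply, AddMonoidHom.add_apply,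
      AddMonoidHom.finsetSum_apply, smul_monomial, varOp_monomial,
      derivation_mul, map_add, map_sum, map_mul, Matrix.mul_apply, Finset.sum_add_distrib]
    rw [Finset.sum_comm, add_assoc]
  have h := DFunLike.congr_fun key Q
  simpa only [AddMonoidHom.comp_apply, DistribSMul.toAddMonoidHom_apply, AddMonoidHom.add_apply,
      AddMonoidHom.finsetSum_apply] using h

theorem wordOp_cons (i : Fin n) (m : FreeMonoid (Fin n)) (Q : SkewPoly σ δ) :
    wordOp (FreeMonoid.of i * m) Q = varOp i (wordOp m Q) := by
  simp only [wordOp, map_mul]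
  rfl

theorem wordOp_one (Q : SkewPoly σ δ) : wordOp 1 Q = Q := by
  simp only [map_one]
  rfl

theorem monomial_mul (m : FreeMonoid (Fin n)) (c : F) (Q : SkewPoly σ δ) :
    monomial m c * Q = c • wordOp m Q :=
  lsum_monomial m c _

theorem add_mul' (P Q R : SkewPoly σ δ) : (P + Q) * R = P * R + Q * R := lsum_add P Q _

theorem smul_mul' (c : F) (P R : SkewPoly σ δ) : (c • P) * R = c • (P * R) := lsum_smul c P _

theorem mul_add' (P Q R : SkewPoly σ δ) : P * (Q + R) = P * Q + P * R := by
  simp only [mul_def, lsum, map_add, smul_add, Finset.sum_add_distrib]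

/-- Right multiplication as an additive map. -/
noncomputable def mulRightHom (R : SkewPoly σ δ) : SkewPoly σ δ →+ SkewPoly σ δ where
  toFun P := P * R
  map_zero' := by simpa using smul_mul' (0 : F) 0 R
  map_add' P Q := add_mul' P Q R

theorem varOp_mul (i : Fin n) (Q R : SkewPoly σ δ) : varOp i Q * R = varOp i (Q * R) := by
  have key : (mulRightHom R).comp (varOp i) = (varOp i).comp (mulRightHom R) := by
    refine hom_ext fun m c => ?_
    simp only [AddMonoidHom.comp_apply, varOp_monomial, map_add, map_sum]
    simp only [mulRightHom, AddMonoidHom.coe_mk, ZeroHom.coe_mk, monomial_mul, wordOp_cons,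
      varOp_smul]
  exact DFunLike.congr_fun key Q

theorem wordOp_mul (m : FreeMonoid (Fin n)) (Q R : SkewPoly σ δ) :
    wordOp m Q * R = wordOp m (Q * R) := by
  induction m using FreeMonoid.inductionOn' with
  | one => simp only [wordOp_one]
  | of_mul i m ih => rw [wordOp_cons, wordOp_cons, varOp_mul, ih]

theorem mul_assoc' (P Q R : SkewPoly σ δ) : P * Q * R = P * (Q * R) := by
  have key : (mulRightHom R).comp (mulRightHom Q) = mulRightHom (Q * R) := by
    refine hom_ext fun m c => ?_
    simp only [AddMonoidHom.comp_apply, mulRightHom, AddMonoidHom.coe_mk, ZeroHom.coe_mk,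
      monomial_mul, smul_mul', wordOp_mul]
  exact DFunLike.congr_fun key P

theorem one_mul' (Q : SkewPoly σ δ) : 1 * Q = Q := by
  rw [one_def, monomial_mul, wordOp_one, one_smul]

theorem varOp_monomial_one (i : Fin n) (m : FreeMonoid (Fin n)) :
    varOp i (monomial m 1 : SkewPoly σ δ) = monomial (FreeMonoid.of i * m) 1 := by
  rw [varOp_monomial, derivation_one]
  simp only [map_one, Matrix.one_apply, Pi.zero_apply, map_zero, add_zero]
  rw [Finset.sum_eq_single i]
  · simp
  · intro j _ hj
    simp [Ne.symm hj]
  · simp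

theorem wordOp_monomial_one (m k : FreeMonoid (Fin n)) :
    wordOp m (monomial k 1 : SkewPoly σ δ) = monomial (m * k) 1 := by
  induction m using FreeMonoid.inductionOn' with
  | one => rw [wordOp_one, one_mul]
  | of_mul i m ih => rw [wordOp_cons, ih, varOp_monomial_one, mul_assoc]

theorem mul_one' (P : SkewPoly σ δ) : P * 1 = P := by
  simp only [mul_def, one_def, wordOp_monomial_one, mul_one]
  exact lsum_one P

/-- The free multivariate skew polynomial ring `F[x; σ, δ]`. -/
noncomputable instance instRing : Ring (SkewPoly σ δ) :=
  { instAddCommGroup with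
    mul := fun P Q => P * Q
    one := 1
    mul_assoc := mul_assoc'
    one_mul := one_mul'
    mul_one := mul_one'
    left_distrib := mul_add'
    right_distrib := add_mul'
    zero_mul := fun Q => (mulRightHom Q).map_zero
    mul_zero := fun P => by
      have h := mul_add' P 0 0
      rw [add_zero] at h
      exact left_eq_add.mp h }

/-- The constant `c`. -/
noncomputable def C (c : F) : SkewPoly σ δ := monomial 1 c

/-- The variable `xᵢ`. -/
noncomputable def X (i : Fin n) : SkewPoly σ δ := monomial (FreeMonoid.of i) 1

theorem C_mul (c : F) (P : SkewPoly σ δ) : C c * P = c • P := by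
  rw [C, monomial_mul, wordOp_one]

theorem X_mul (i : Fin n) (P : SkewPoly σ δ) : X i * P = varOp i P := by
  rw [X, monomial_mul, one_smul]
  have h := wordOp_cons (σ := σ) (δ := δ) i 1 P
  rwa [mul_one, wordOp_one] at h

/-- The rule that defines the product: `xᵢ c = ∑ⱼ σᵢⱼ(c) xⱼ + δᵢ(c)`. -/
theorem X_mul_C (i : Fin n) (c : F) :
    (X i * C c : SkewPoly σ δ) =
      (∑ j, (C (σ c i j) * X j : SkewPoly σ δ)) + (C (δ.toAddMonoidHom c i) : SkewPoly σ δ) := by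
  simp only [X_mul, C_mul]
  simp only [C, X, varOp_monomial, smul_monomial, mul_one]

/-- Monomials multiply by appending. -/
theorem monomial_one_mul_monomial_one (m k : FreeMonoid (Fin n)) :
    (monomial m 1 * monomial k 1 : SkewPoly σ δ) = monomial (m * k) 1 := by
  rw [monomial_mul, wordOp_monomial_one, one_smul]

end Ring

section Evaluation

variable {F : Type*} [DivisionRing F] {n : ℕ}
  (σ : F →+* Matrix (Fin n) (Fin n) F) (δ : SkewDerivation σ)

/-- The operator `D_a(β) = σ(β) a + δ(β)`. -/
def opD (a : Fin n → F) (β : F) : Fin n → F :=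
  Matrix.mulVec (σ β) a + δ.toAddMonoidHom β

/-- The operators `D_a^m` for monomials `m`: `D_a^1 = id` and `D_a^{xᵢ m} = (D_a ∘ D_a^m)ᵢ`. -/
def opWord (a : Fin n → F) (m : FreeMonoid (Fin n)) (β : F) : F :=
  (FreeMonoid.toList m).foldr (fun i c => opD σ δ a c i) β

variable {σ δ}

/-- The linearized evaluation `P^{D_a}(β) = ∑ₘ Pₘ D_a^m(β)`. -/
noncomputable def linEval (P : SkewPoly σ δ) (a : Fin n → F) (β : F) : F :=
  lsum P fun m => opWord σ δ a m β

/-- The left ideal `(x₁ - a₁, …, xₙ - aₙ)`. -/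
noncomputable def pointIdeal (σ : F →+* Matrix (Fin n) (Fin n) F) (δ : SkewDerivation σ)
    (a : Fin n → F) : Ideal (SkewPoly σ δ) :=
  Ideal.span (Set.range fun i => (X i - C (a i) : SkewPoly σ δ))

theorem opD_apply (a : Fin n → F) (β : F) (i : Fin n) :
    opD σ δ a β i = (∑ j, σ β i j * a j) + δ.toAddMonoidHom β i := rfl

theorem opD_add (a : Fin n → F) (β γ : F) (i : Fin n) :
    opD σ δ a (β + γ) i = opD σ δ a β i + opD σ δ a γ i := by
  simp only [opD_apply, map_add, Matrix.add_apply, add_mul, Finset.sum_add_distrib, Pi.add_apply]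
  abel

theorem opD_mul (a : Fin n → F) (β γ : F) (i : Fin n) :
    opD σ δ a (β * γ) i =
      (∑ j, σ β i j * opD σ δ a γ j) + δ.toAddMonoidHom β i * γ := by
  simp only [opD_apply, map_mul, Matrix.mul_apply, derivation_mul, mul_add, Finset.sum_add_distrib,
    Finset.sum_mul, Finset.mul_sum, mul_assoc]
  rw [Finset.sum_comm, add_assoc]

theorem opWord_cons (a : Fin n → F) (i : Fin n) (m : FreeMonoid (Fin n)) (β : F) :
    opWord σ δ a (FreeMonoid.of i * m) β = opD σ δ a (opWord σ δ a m β) i := rfl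

theorem opD_linEval (P : SkewPoly σ δ) (a : Fin n → F) (β : F) (i : Fin n) :
    linEval (varOp i P) a β = opD σ δ a (linEval P a β) i := by
  let L : SkewPoly σ δ →+ F :=
    (lsumHom (σ := σ) (δ := δ) fun m => opWord σ δ a m β).toAddMonoidHom
  let Di : F →+ F := AddMonoidHom.mk' (fun c => opD σ δ a c i) fun x y => opD_add a x y i
  have key : L.comp (varOp i) = Di.comp L := by
    refine hom_ext fun m c => ?_
    have hL : ∀ k d, L (monomial k d) = d * opWord σ δ a k β := fun k d => lsum_monomial k d _
    simp only [AddMonoidHom.comp_apply, varOp_monomial, map_add, map_sum, hL]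
    exact (opD_mul a c (opWord σ δ a m β) i).symm
  exact DFunLike.congr_fun key P

theorem linEval_add (P Q : SkewPoly σ δ) (a : Fin n → F) (β : F) :
    linEval (P + Q) a β = linEval P a β + linEval Q a β := lsum_add P Q _

theorem linEval_smul (c : F) (P : SkewPoly σ δ) (a : Fin n → F) (β : F) :
    linEval (c • P) a β = c * linEval P a β := lsum_smul c P _

theorem linEval_monomial (m : FreeMonoid (Fin n)) (c : F) (a : Fin n → F) (β : F) :
    linEval (monomial m c : SkewPoly σ δ) a β = c * opWord σ δ a m β := lsum_monomial m c _

theorem linEval_wordOp (m : FreeMonoid (Fin n)) (P : SkewPoly σ δ) (a : Fin n → F) (β : F) :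
    linEval (wordOp m P) a β = opWord σ δ a m (linEval P a β) := by
  induction m using FreeMonoid.inductionOn' with
  | one => rw [wordOp_one]; rfl
  | of_mul i m ih => rw [wordOp_cons, opD_linEval, ih, opWord_cons]

theorem linEval_mul (P Q : SkewPoly σ δ) (a : Fin n → F) (β : F) :
    linEval (P * Q) a β = linEval P a (linEval Q a β) := by
  have h : (lsumHom (σ := σ) (δ := δ) fun m => opWord σ δ a m β) (P * Q) =
      linEval P a (linEval Q a β) := by
    rw [mul_def, lsum, map_sum]
    refine Finset.sum_congr rfl fun m _ => ?_
    rw [map_smul]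
    exact congrArg _ (linEval_wordOp m Q a β)
  exact h

theorem linEval_C (c : F) (a : Fin n → F) (β : F) :
    linEval (C c : SkewPoly σ δ) a β = c * β := linEval_monomial 1 c a β

theorem opD_one (a : Fin n → F) (i : Fin n) : opD σ δ a 1 i = a i := by
  rw [opD_apply, derivation_one]
  simp [Matrix.one_apply]

theorem linEval_zero_right (P : SkewPoly σ δ) (a : Fin n → F) : linEval P a 0 = 0 := by
  have h := linEval_mul P 0 a 1
  have h0 : linEval (0 : SkewPoly σ δ) a 1 = 0 := by
    simpa using linEval_smul (0 : F) (0 : SkewPoly σ δ) a 1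
  rwa [mul_zero, h0, eq_comm] at h

theorem linEval_one_eq_zero_of_mem {a : Fin n → F} {P : SkewPoly σ δ}
    (hP : P ∈ pointIdeal σ δ a) : linEval P a 1 = 0 := by
  induction hP using Submodule.span_induction with
  | mem P hP =>
    obtain ⟨i, rfl⟩ := hP
    have h : linEval (X i - C (a i) : SkewPoly σ δ) a 1 + linEval (C (a i) : SkewPoly σ δ) a 1 =
        linEval (X i : SkewPoly σ δ) a 1 := by
      rw [← linEval_add, sub_add_cancel]
    have hX : linEval (X i : SkewPoly σ δ) a 1 = a i := by
      rw [X, linEval_monomial, one_mul]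
      exact opD_one a i
    rw [hX, linEval_C, mul_one] at h
    exact add_eq_right.mp h
  | zero => simpa using linEval_smul (0 : F) (0 : SkewPoly σ δ) a 1
  | add P Q _ _ hP hQ => rw [linEval_add, hP, hQ, add_zero]
  | smul R P _ hP => rw [smul_eq_mul, linEval_mul, hP, linEval_zero_right]

theorem C_add (c d : F) : (C (c + d) : SkewPoly σ δ) = C c + C d := map_add (monomial 1) c d

theorem C_mul_C (c d : F) : (C c * C d : SkewPoly σ δ) = C (c * d) := by
  rw [C_mul, C, smul_monomial]; rfl

theorem sub_C_linEval_mem (P : SkewPoly σ δ) (a : Fin n → F) :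
    P - C (linEval P a 1) ∈ pointIdeal σ δ a := by
  have hword : ∀ m : FreeMonoid (Fin n),
      (monomial m 1 - C (opWord σ δ a m 1) : SkewPoly σ δ) ∈ pointIdeal σ δ a := by
    intro m
    induction m using FreeMonoid.inductionOn' with
    | one =>
      have : (monomial 1 1 - C (opWord σ δ a 1 1) : SkewPoly σ δ) = 0 := sub_self _
      rw [this]
      exact zero_mem _
    | of_mul i m ih =>
      have h1 := (pointIdeal σ δ a).mul_mem_left (X i) ih
      set c := opWord σ δ a m 1
      have h2 : (∑ j, C (σ c i j) * (X j - C (a j)) : SkewPoly σ δ) ∈ pointIdeal σ δ a :=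
        Submodule.sum_mem _ fun j _ =>
          (pointIdeal σ δ a).mul_mem_left _ (Ideal.subset_span ⟨j, rfl⟩)
      have h3 := add_mem h1 h2
      have hsum : (C (∑ j, σ c i j * a j) : SkewPoly σ δ) = ∑ j, C (σ c i j * a j) :=
        map_sum (monomial 1) _ _
      have e : (X i * (monomial m 1 - C c) : SkewPoly σ δ) +
          (∑ j, (C (σ c i j) * (X j - C (a j)) : SkewPoly σ δ)) =
          monomial (FreeMonoid.of i * m) 1 - C (opWord σ δ a (FreeMonoid.of i * m) 1) := by
        rw [opWord_cons, opD_apply, C_add, hsum]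
        simp only [mul_sub, X_mul_C, Finset.sum_sub_distrib, C_mul_C]
        rw [X_mul, varOp_monomial_one]
        abel
      rwa [e] at h3
  have h : (∑ m ∈ P.support, C (P.coeff m) * (monomial m 1 - C (opWord σ δ a m 1)) :
      SkewPoly σ δ) ∈ pointIdeal σ δ a :=
    Submodule.sum_mem _ fun m _ => (pointIdeal σ δ a).mul_mem_left _ (hword m)
  have e : (∑ m ∈ P.support, C (P.coeff m) * (monomial m 1 - C (opWord σ δ a m 1)) :
      SkewPoly σ δ) = P - C (linEval P a 1) := by
    simp only [mul_sub, Finset.sum_sub_distrib, C_mul_C]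
    simp only [C_mul]
    congr 1
    · exact lsum_one P
    · exact (map_sum (monomial 1) _ _).symm
  rwa [e] at h

/-- The evaluation is well defined. -/
theorem existsUnique_eval (P : SkewPoly σ δ) (a : Fin n → F) :
    ∃! c : F, P - C c ∈ pointIdeal σ δ a := by
  refine ⟨linEval P a 1, sub_C_linEval_mem P a, fun c hc => ?_⟩
  have h := linEval_add (P - C c) (C c) a 1
  rw [sub_add_cancel, linEval_one_eq_zero_of_mem hc, linEval_C, mul_one, zero_add] at h
  exact h.symm

/-- The (skew) evaluation `P(a)`: the unique `c ∈ F` with `P - c ∈ (x₁ - a₁, …, xₙ - aₙ)`. -/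
noncomputable def eval (P : SkewPoly σ δ) (a : Fin n → F) : F :=
  (existsUnique_eval P a).choose

theorem eval_eq_linEval_one (P : SkewPoly σ δ) (a : Fin n → F) : eval P a = linEval P a 1 :=
  (existsUnique_eval P a).unique (existsUnique_eval P a).choose_spec.1 (sub_C_linEval_mem P a)

/-- The skew evaluation map `P ↦ (P(b))_{b ∈ B}` over `B`, as a left linear map. -/
noncomputable def evalOn (σ : F →+* Matrix (Fin n) (Fin n) F) (δ : SkewDerivation σ)
    (B : Set (Fin n → F)) : SkewPoly σ δ →ₗ[F] (B → F) where
  toFun P b := eval P b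
  map_add' P Q := by
    funext b
    simp only [eval_eq_linEval_one, linEval_add, Pi.add_apply]
  map_smul' c P := by
    funext b
    simp only [eval_eq_linEval_one, linEval_smul, Pi.smul_apply, smul_eq_mul, RingHom.id_apply]

end Evaluation

end SkewPoly

section PClosed

variable {F : Type*} [DivisionRing F] {n : ℕ}
  (σ : F →+* Matrix (Fin n) (Fin n) F) (δ : SkewDerivation σ)

/-- The set of common zeros of a set of skew polynomials. -/
def zeroSet (A : Set (SkewPoly σ δ)) : Set (Fin n → F) :=
  {a | ∀ P ∈ A, SkewPoly.eval P a = 0}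

/-- The skew polynomials that vanish on `Ω`. -/
def vanishing (Ω : Set (Fin n → F)) : Set (SkewPoly σ δ) :=
  {P | ∀ a ∈ Ω, SkewPoly.eval P a = 0}

/-- The P-closure of a set of points. -/
def pClosure (Ω : Set (Fin n → F)) : Set (Fin n → F) :=
  zeroSet σ δ (vanishing σ δ Ω)

/-- `Ω` is P-independent: no point of `Ω` lies in the P-closure of the other ones. -/
def PIndependent (Ω : Set (Fin n → F)) : Prop :=
  ∀ a ∈ Ω, a ∉ pClosure σ δ (Ω \ {a})

/-- `B` is a P-basis of the (automatically P-closed) set `Ω`: a P-independent subset of `Ω` with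
P-closure `Ω`. -/
def IsPBasis (B Ω : Set (Fin n → F)) : Prop :=
  B ⊆ Ω ∧ PIndependent σ δ B ∧ pClosure σ δ B = Ω

/-- The rank of a finitely generated P-closed set `Ω`: the number of elements of any of its finite
P-bases (see `pRank_eq`). -/
noncomputable def pRank (Ω : Set (Fin n → F)) : ℕ :=
  sInf {k | ∃ A : Finset (Fin n → F), IsPBasis σ δ (A : Set (Fin n → F)) Ω ∧ A.card = k}

variable {σ δ}

theorem evalOn_ker {B Ω : Set (Fin n → F)} (h : IsPBasis σ δ B Ω) (P : SkewPoly σ δ) :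
    P ∈ LinearMap.ker (SkewPoly.evalOn σ δ B) ↔ P ∈ vanishing σ δ Ω := by
  rw [LinearMap.mem_ker]
  constructor
  · intro hP a ha
    rw [← h.2.2] at ha
    exact ha P fun b hb => congrFun hP ⟨b, hb⟩
  · intro hP
    funext b
    exact hP b (h.1 b.2)

theorem evalOn_surjective {A : Finset (Fin n → F)}
    (h : PIndependent σ δ (A : Set (Fin n → F))) :
    Function.Surjective (SkewPoly.evalOn σ δ (A : Set (Fin n → F))) := by
  classical
  have hdual : ∀ a : (A : Set (Fin n → F)), ∃ P : SkewPoly σ δ,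
      SkewPoly.evalOn σ δ (A : Set (Fin n → F)) P = Pi.single a 1 := by
    intro a
    have ha := h a a.2
    simp only [pClosure, zeroSet, Set.mem_ofPred_eq, not_forall] at ha
    obtain ⟨P, hP, hPa⟩ := ha
    refine ⟨(SkewPoly.eval P a)⁻¹ • P, ?_⟩
    rw [map_smul]
    funext b
    by_cases hb : b = a
    · subst hb
      rw [Pi.single_eq_same]
      exact inv_mul_cancel₀ hPa
    · rw [Pi.single_eq_of_ne hb]
      have : SkewPoly.eval P b = 0 := hP b ⟨b.2, fun e => hb (Subtype.ext e)⟩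
      change _ * SkewPoly.eval P b = 0
      rw [this, mul_zero]
  choose D hD using hdual
  intro f
  refine ⟨∑ a, f a • D a, ?_⟩
  rw [map_sum]
  funext b
  simp only [map_smul, hD, Finset.sum_apply, Pi.smul_apply, smul_eq_mul, Pi.single_apply,
    mul_ite, mul_one, mul_zero, Finset.sum_ite_eq, Finset.mem_univ, if_true]

/-- Two finite P-bases of the same set have the same number of elements. -/
theorem IsPBasis.card_eq {A A' : Finset (Fin n → F)} {Ω : Set (Fin n → F)}
    (h : IsPBasis σ δ (A : Set (Fin n → F)) Ω) (h' : IsPBasis σ δ (A' : Set (Fin n → F)) Ω) :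
    A.card = A'.card := by
  have hk : LinearMap.ker (SkewPoly.evalOn σ δ (A : Set (Fin n → F))) =
      LinearMap.ker (SkewPoly.evalOn σ δ (A' : Set (Fin n → F))) := by
    ext P
    rw [evalOn_ker h, evalOn_ker h']
  have e1 := (LinearMap.quotKerEquivOfSurjective _ (evalOn_surjective h.2.1)).finrank_eq
  have e2 := (LinearMap.quotKerEquivOfSurjective _ (evalOn_surjective h'.2.1)).finrank_eq
  rw [hk, e2] at e1
  rw [Module.finrank_fintype_fun_eq_card, Module.finrank_fintype_fun_eq_card] at e1
  simpa using e1.symm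

theorem pRank_eq {A : Finset (Fin n → F)} {Ω : Set (Fin n → F)}
    (h : IsPBasis σ δ (A : Set (Fin n → F)) Ω) : pRank σ δ Ω = A.card := by
  have : {k | ∃ A : Finset (Fin n → F), IsPBasis σ δ (A : Set (Fin n → F)) Ω ∧ A.card = k} =
      {A.card} := by
    ext k
    constructor
    · rintro ⟨A', hA', rfl⟩
      exact hA'.card_eq h
    · rintro rfl
      exact ⟨A, h, rfl⟩
  rw [pRank, this, csInf_singleton]

end PClosed

section Conjugacy

variable {F : Type*} [DivisionRing F] {n : ℕ}
  (σ : F →+* Matrix (Fin n) (Fin n) F) (δ : SkewDerivation σ)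

/-- The conjugate `a^β = D_a(β) β⁻¹` of `a` with exponent `β` (used for `β ≠ 0`). -/
def conjugate (a : Fin n → F) (β : F) : Fin n → F :=
  fun i => SkewPoly.opD σ δ a β i * β⁻¹

/-- `b` is conjugate to `a`. -/
def IsConjugate (a b : Fin n → F) : Prop :=
  ∃ β : F, β ≠ 0 ∧ b = conjugate σ δ a β

/-- The centralizer `K_a = {β | D_a(β) = a β}`, a division subring of `F`. -/
def centralizerAt (a : Fin n → F) : Subfield F where
  carrier := {β | SkewPoly.opD σ δ a β = fun i => a i * β}
  zero_mem' := by
    funext i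
    simp [SkewPoly.opD_apply]
  one_mem' := by
    funext i
    rw [SkewPoly.opD_one, mul_one]
  add_mem' := by
    intro x y hx hy
    funext i
    rw [SkewPoly.opD_add, congrFun hx i, congrFun hy i, mul_add]
  neg_mem' := by
    intro x hx
    funext i
    have h := SkewPoly.opD_add (σ := σ) (δ := δ) a x (-x) i
    have h0 : SkewPoly.opD σ δ a 0 i = 0 := by simp [SkewPoly.opD_apply]
    rw [add_neg_cancel, h0, congrFun hx i] at h
    rw [mul_neg]
    exact (neg_eq_of_add_eq_zero_right h.symm).symm
  mul_mem' := by
    intro x y hx hy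
    funext i
    rw [SkewPoly.opD_mul, ← mul_assoc, ← congrFun hx i, SkewPoly.opD_apply, add_mul,
      Finset.sum_mul]
    congr 1
    exact Finset.sum_congr rfl fun j _ => by rw [congrFun hy j, mul_assoc]
  inv_mem' := by
    intro x hx
    rcases eq_or_ne x 0 with rfl | h0
    · rw [inv_zero]
      exact hx
    funext i
    have h1 : ∀ i, (∑ j, σ x⁻¹ i j * (a j * x)) + δ.toAddMonoidHom x⁻¹ i * x = a i := by
      intro i
      have h := SkewPoly.opD_mul (σ := σ) (δ := δ) a x⁻¹ x i
      rw [inv_mul_cancel₀ h0, SkewPoly.opD_one] at h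
      rw [h]
      congr 1
      exact Finset.sum_congr rfl fun j _ => by rw [congrFun hx j]
    rw [← h1 i, SkewPoly.opD_apply, add_mul, Finset.sum_mul, mul_assoc _ x, mul_inv_cancel₀ h0,
      mul_one]
    congr 1
    exact Finset.sum_congr rfl fun j _ => by
      rw [mul_assoc, mul_assoc (a j), mul_inv_cancel₀ h0, mul_one]

end Conjugacy

section Weights

variable {F : Type*} [DivisionRing F]

/-- `F` as a right vector space over a division subring `K`. -/
instance rightModule (K : Subfield F) : Module (↥K)ᵐᵒᵖ F :=
  Module.compHom F (RingHom.op K.subtype)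

/-- The rank weight: the dimension over `K` of the right `K`-span of the entries. -/
noncomputable def rankWeight (K : Subfield F) {m : ℕ} (c : Fin m → F) : ℕ :=
  Module.finrank (↥K)ᵐᵒᵖ (Submodule.span (↥K)ᵐᵒᵖ (Set.range c))

/-- The sum-rank weight with lengths `m i` and division subrings `K i`. -/
noncomputable def sumRankWeight {ℓ : ℕ} (K : Fin ℓ → Subfield F) (m : Fin ℓ → ℕ)
    (c : (Σ i : Fin ℓ, Fin (m i)) → F) : ℕ :=
  ∑ i, rankWeight (K i) fun j : Fin (m i) => c ⟨i, j⟩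

variable {n : ℕ} (σ : F →+* Matrix (Fin n) (Fin n) F) (δ : SkewDerivation σ)

/-- The zeros of `P` in `Ω`. -/
def zerosIn (Ω : Set (Fin n → F)) (P : SkewPoly σ δ) : Set (Fin n → F) :=
  {a ∈ Ω | SkewPoly.eval P a = 0}

/-- The skew weight of a skew polynomial over `Ω`: `Rk(Ω) - Rk(Z_Ω(P))`, as an integer. -/
noncomputable def skewWeightPoly (Ω : Set (Fin n → F)) (P : SkewPoly σ δ) : ℤ :=
  (pRank σ δ Ω : ℤ) - (pRank σ δ (zerosIn σ δ Ω P) : ℤ)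

/-- `P` has degree less than the number of elements of `B` and takes the values `f` on `B`. -/
def Interpolates (B : Set (Fin n → F)) (f : B → F) (P : SkewPoly σ δ) : Prop :=
  P.degree < (B.ncard : WithBot ℕ) ∧ SkewPoly.evalOn σ δ B P = f

open Classical in
/-- The skew weight of `f : B → F`: the skew weight over the P-closure of `B` of a skew polynomial
of degree less than `|B|` with values `f` on `B`. Such polynomials exist, and they all have the same
skew weight, if `B` is finite and P-independent (the value is `0` if there are none). -/
noncomputable def skewWeight (B : Set (Fin n → F)) (f : B → F) : ℤ :=
  if h : ∃ P : SkewPoly σ δ, Interpolates σ δ B f P then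
    skewWeightPoly σ δ (pClosure σ δ B) h.choose
  else 0

/-- The skew Reed–Muller code of degree `d` at the points `b`. -/
def skewRMCode {ι : Type*} (d : ℕ) (b : ι → Fin n → F) : Set (ι → F) :=
  {c | ∃ P : SkewPoly σ δ, P.degree < (d : WithBot ℕ) ∧ c = fun p => SkewPoly.eval P (b p)}

/-- The linearized Reed–Muller code of degree `d` at the conjugacy representatives `a` and the
exponents `β`. -/
def linRMCode {ℓ : ℕ} {m : Fin ℓ → ℕ} (d : ℕ) (a : Fin ℓ → Fin n → F)
    (β : (i : Fin ℓ) → Fin (m i) → F) : Set ((Σ i : Fin ℓ, Fin (m i)) → F) :=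
  {c | ∃ P : SkewPoly σ δ, P.degree < (d : WithBot ℕ) ∧
    c = fun p => SkewPoly.linEval P (a p.1) (β p.1 p.2)}

end Weights

/-! The bridge between the two worlds is `eval_conjugate_mul`: P(a^β) β = P^{D_a}(β). It gives part
2 at once. For part 1, P^{D_a} is right linear over the centralizer K_a, so zeros of P in the
conjugacy class of a become the kernel of a linear map.

Let W_i be the right K_{a_i}-span of the exponents β^{(i)}_j. The points of Ω are exactly the
conjugates a_i^γ with 0 ≠ γ ∈ W_i (`conjugate_mem_pClosure`, `exists_exponent_of_mem_pClosure`), and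
P-independence of such points matches linear independence of their exponents, class by class
(`linearIndependent_exponents`, `injective_and_pIndependent_conjugate`). Hence bases of the spaces
W_i ∩ ker P^{D_{a_i}} yield a P-basis of Z_Ω(P) (`isPBasis_zerosIn`). By rank-nullity on each W_i,
of dimension M_i, the difference Rk(Ω) - Rk(Z_Ω(P)) is the sum of the dimensions of the spans of
P^{D_{a_i}}(β^{(i)}_j) = P(b^{(i)}_j) β^{(i)}_j, which is the sum-rank weight.

A polynomial of degree less than M with given values exists (`exists_degree_lt_eval_eq`) because the
spans of values of words of length less than d grow strictly with d until they are everything. -/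

namespace SkewPoly

variable {F : Type*} [DivisionRing F] {n : ℕ}
  {σ : F →+* Matrix (Fin n) (Fin n) F} {δ : SkewDerivation σ}

/-! ### Conjugation and the linearized evaluation. -/

theorem opD_zero (a : Fin n → F) (i : Fin n) : opD σ δ a 0 i = 0 := by
  simp [opD_apply]

/-- The product rule for D_a(γβ), with D_a(β) rewritten as a^β β. Iterated along words, this
intertwining relation becomes the bridge `eval_conjugate_mul`. -/
theorem opD_conjugate_mul (a : Fin n → F) {β : F} (hβ : β ≠ 0) (γ : F) (i : Fin n) :
    opD σ δ (conjugate σ δ a β) γ i * β = opD σ δ a (γ * β) i := by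
  rw [opD_mul, opD_apply, add_mul, Finset.sum_mul]
  congr 1
  refine Finset.sum_congr rfl fun j _ => ?_
  rw [conjugate, mul_assoc, mul_assoc, inv_mul_cancel₀ hβ, mul_one]

theorem conjugate_one (a : Fin n → F) : conjugate σ δ a 1 = a := by
  funext i
  rw [conjugate, opD_one, inv_one, mul_one]

/-- With `conjugate_one`, this makes conjugation an action of the nonzero elements of F, so
exponents can be composed and inverted. -/
theorem conjugate_mul (a : Fin n → F) {β : F} (hβ : β ≠ 0) (γ : F) :
    conjugate σ δ a (γ * β) = conjugate σ δ (conjugate σ δ a β) γ := by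
  funext i
  conv_lhs => rw [conjugate, ← opD_conjugate_mul a hβ, mul_inv_rev, mul_assoc,
    mul_inv_cancel_left₀ hβ]
  rfl

theorem opD_eq_iff_conjugate_eq {a c : Fin n → F} {β : F} (hβ : β ≠ 0) :
    (opD σ δ a β = fun i => c i * β) ↔ conjugate σ δ a β = c := by
  simp only [funext_iff, conjugate]
  exact forall_congr' fun i => (mul_inv_eq_iff_eq_mul₀ hβ).symm

theorem conjugate_inv_of_eq {a c : Fin n → F} {β : F} (hβ : β ≠ 0)
    (h : conjugate σ δ a β = c) : conjugate σ δ c β⁻¹ = a := by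
  rw [← h, ← conjugate_mul a hβ, inv_mul_cancel₀ hβ, conjugate_one]

/-- Exponents with the same conjugate differ by a right factor in the centralizer. -/
theorem inv_mul_mem_centralizerAt {a : Fin n → F} {β γ : F} (hβ : β ≠ 0) (hγ : γ ≠ 0)
    (h : conjugate σ δ a γ = conjugate σ δ a β) : β⁻¹ * γ ∈ centralizerAt σ δ a := by
  change opD σ δ a (β⁻¹ * γ) = fun i => a i * (β⁻¹ * γ)
  rw [opD_eq_iff_conjugate_eq (mul_ne_zero (inv_ne_zero hβ) hγ), conjugate_mul a hγ, h]
  exact conjugate_inv_of_eq hβ rfl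

theorem opD_mul_of_mem (a : Fin n → F) (γ : F) {κ : F} (hκ : κ ∈ centralizerAt σ δ a)
    (i : Fin n) : opD σ δ a (γ * κ) i = opD σ δ a γ i * κ := by
  have h : opD σ δ a κ = fun i => a i * κ := hκ
  rw [opD_mul, h, opD_apply, add_mul, Finset.sum_mul]
  simp only [mul_assoc]

theorem opWord_conjugate_mul (a : Fin n → F) {β : F} (hβ : β ≠ 0) (γ : F)
    (m : FreeMonoid (Fin n)) :
    opWord σ δ (conjugate σ δ a β) m γ * β = opWord σ δ a m (γ * β) := by
  induction m using FreeMonoid.inductionOn' with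
  | one => rfl
  | of_mul i m ih => rw [opWord_cons, opWord_cons, opD_conjugate_mul a hβ, ih]

theorem opWord_add (a : Fin n → F) (β γ : F) (m : FreeMonoid (Fin n)) :
    opWord σ δ a m (β + γ) = opWord σ δ a m β + opWord σ δ a m γ := by
  induction m using FreeMonoid.inductionOn' with
  | one => rfl
  | of_mul i m ih => rw [opWord_cons, ih, opD_add]; rfl

theorem opWord_mul_of_mem (a : Fin n → F) (γ : F) {κ : F} (hκ : κ ∈ centralizerAt σ δ a)
    (m : FreeMonoid (Fin n)) : opWord σ δ a m (γ * κ) = opWord σ δ a m γ * κ := by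
  induction m using FreeMonoid.inductionOn' with
  | one => rfl
  | of_mul i m ih => rw [opWord_cons, ih, opD_mul_of_mem a _ hκ]; rfl

/-- The skew evaluation at a conjugate in terms of the linearized evaluation. -/
theorem eval_conjugate_mul (P : SkewPoly σ δ) (a : Fin n → F) {β : F} (hβ : β ≠ 0) :
    eval P (conjugate σ δ a β) * β = linEval P a β := by
  simp only [eval_eq_linEval_one, linEval, lsum, smul_eq_mul, Finset.sum_mul, mul_assoc,
    opWord_conjugate_mul a hβ, one_mul]

theorem eval_conjugate_eq_zero_iff (P : SkewPoly σ δ) (a : Fin n → F) {β : F} (hβ : β ≠ 0) :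
    eval P (conjugate σ δ a β) = 0 ↔ linEval P a β = 0 := by
  rw [← eval_conjugate_mul P a hβ, mul_eq_zero, or_iff_left hβ]

/-- Multiplying on the left by a variable keeps the zeros of P and turns a value 1 at a into the
coordinate a_i. This is how dual polynomials will detect conjugacy. -/
theorem eval_X_mul (i : Fin n) (P : SkewPoly σ δ) (a : Fin n → F) :
    eval (X i * P) a = opD σ δ a (eval P a) i := by
  rw [X_mul, eval_eq_linEval_one, eval_eq_linEval_one, opD_linEval]

theorem eval_one (a : Fin n → F) : eval (1 : SkewPoly σ δ) a = 1 := by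
  rw [eval_eq_linEval_one, one_def, linEval_monomial, one_mul]
  rfl

theorem op_smul_eq_mul (K : Subfield F) (k : (↥K)ᵐᵒᵖ) (x : F) : k • x = x * (k.unop : F) := rfl

/-- The linearized evaluation at `a` is right linear over the centralizer of `a`. -/
noncomputable def linEvalHom (P : SkewPoly σ δ) (a : Fin n → F) :
    F →ₗ[(↥(centralizerAt σ δ a))ᵐᵒᵖ] F where
  toFun := linEval P a
  map_add' β γ := by
    simp only [linEval, lsum, opWord_add, smul_add, Finset.sum_add_distrib]
  map_smul' k β := by
    simp only [linEval, lsum, op_smul_eq_mul, opWord_mul_of_mem a β k.unop.2, smul_eq_mul,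
      Finset.sum_mul, mul_assoc, RingHom.id_apply]

theorem linEvalHom_apply (P : SkewPoly σ δ) (a : Fin n → F) (β : F) :
    linEvalHom P a β = linEval P a β := rfl

theorem degree_lt_iff (P : SkewPoly σ δ) (d : ℕ) :
    P.degree < (d : WithBot ℕ) ↔ ∀ m, d ≤ FreeMonoid.length m → P.coeff m = 0 := by
  refine (Finset.sup_lt_iff (WithBot.bot_lt_coe d)).trans (forall_congr' fun m => ?_)
  have h : m ∈ P.support ↔ P.coeff m ≠ 0 := Finsupp.mem_support_iff
  have h2 : ((FreeMonoid.length m : ℕ) : WithBot ℕ) < (d : WithBot ℕ) ↔ FreeMonoid.length m < d :=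
    WithBot.coe_lt_coe
  refine (imp_congr h h2).trans ?_
  rw [← not_le]
  tauto

theorem coeff_add (P Q : SkewPoly σ δ) (m : FreeMonoid (Fin n)) :
    (P + Q).coeff m = P.coeff m + Q.coeff m := rfl

theorem coeff_smul (c : F) (P : SkewPoly σ δ) (m : FreeMonoid (Fin n)) :
    (c • P).coeff m = c * P.coeff m := rfl

theorem coeff_monomial_of_ne {m k : FreeMonoid (Fin n)} (h : k ≠ m) (c : F) :
    (monomial m c : SkewPoly σ δ).coeff k = 0 := Finsupp.single_eq_of_ne h

/-! ### Interpolation in degree less than the number of points. -/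

section Interpolation

variable (σ δ) {ι : Type*} (b : ι → Fin n → F)

/-- The span of the values at the points `b` of the monomials of degree less than `d`. -/
def wordSpan (d : ℕ) : Submodule F (ι → F) :=
  Submodule.span F ((fun m p => opWord σ δ (b p) m 1) '' {m | FreeMonoid.length m < d})

variable {σ δ b}

theorem opWord_mem_wordSpan {d : ℕ} {m : FreeMonoid (Fin n)} (h : FreeMonoid.length m < d) :
    (fun p => opWord σ δ (b p) m 1) ∈ wordSpan σ δ b d :=
  Submodule.subset_span ⟨m, h, rfl⟩

theorem wordSpan_mono {d e : ℕ} (h : d ≤ e) : wordSpan σ δ b d ≤ wordSpan σ δ b e :=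
  Submodule.span_mono (Set.image_mono fun _ hm => lt_of_lt_of_le hm h)

theorem exists_of_mem_wordSpan {d : ℕ} {v : ι → F} (hv : v ∈ wordSpan σ δ b d) :
    ∃ P : SkewPoly σ δ, P.degree < (d : WithBot ℕ) ∧ ∀ p, eval P (b p) = v p := by
  simp only [degree_lt_iff, eval_eq_linEval_one]
  induction hv using Submodule.span_induction with
  | mem v hv =>
    obtain ⟨m, hm, rfl⟩ := hv
    refine ⟨monomial m 1, fun k hk => coeff_monomial_of_ne ?_ 1, fun p => ?_⟩
    · rintro rfl
      exact absurd hm (not_lt.mpr hk)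
    · rw [linEval_monomial, one_mul]
  | zero => exact ⟨0, fun _ _ => rfl, fun p => rfl⟩
  | add v w _ _ hv hw =>
    obtain ⟨P, hP, hPv⟩ := hv
    obtain ⟨Q, hQ, hQw⟩ := hw
    exact ⟨P + Q, fun m hm => by rw [coeff_add, hP m hm, hQ m hm, add_zero],
      fun p => by rw [linEval_add, hPv, hQw]; rfl⟩
  | smul c v _ hv =>
    obtain ⟨P, hP, hPv⟩ := hv
    exact ⟨c • P, fun m hm => by rw [coeff_smul, hP m hm, mul_zero],
      fun p => by rw [linEval_smul, hPv]; rfl⟩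

theorem opD_mem_wordSpan {d : ℕ} {v : ι → F} (hv : v ∈ wordSpan σ δ b d) (i : Fin n) :
    (fun p => opD σ δ (b p) (v p) i) ∈ wordSpan σ δ b (d + 1) := by
  -- The operator is not linear: by the product rule, the i-th coordinate on c v involves every
  -- coordinate on v, so the induction must carry all i at once.
  induction hv using Submodule.span_induction generalizing i with
  | mem v hv =>
    obtain ⟨m, hm, rfl⟩ := hv
    simp only [← opWord_cons]
    refine opWord_mem_wordSpan ?_
    rw [FreeMonoid.length_mul, FreeMonoid.length_of, add_comm]
    exact Nat.add_lt_add_right hm 1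
  | zero => simp only [Pi.zero_apply, opD_zero]; exact zero_mem _
  | add v w _ _ hv hw => simp only [Pi.add_apply, opD_add]; exact add_mem (hv i) (hw i)
  | smul c v hmem hv =>
    have e : (fun p => opD σ δ (b p) ((c • v) p) i) =
        (∑ j, σ c i j • fun p => opD σ δ (b p) (v p) j) + δ.toAddMonoidHom c i • v := by
      funext p
      simp [opD_mul]
    rw [e]
    exact add_mem (Submodule.sum_mem _ fun j _ => Submodule.smul_mem _ _ (hv j))
      (Submodule.smul_mem _ _ (wordSpan_mono d.le_succ hmem))

/-- Once the chain of spans stalls, it is stable under every D operator, so longer words contribute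
nothing new. -/
theorem opWord_mem_of_wordSpan_succ_le {d : ℕ}
    (h : wordSpan σ δ b (d + 1) ≤ wordSpan σ δ b d) (m : FreeMonoid (Fin n)) :
    (fun p => opWord σ δ (b p) m 1) ∈ wordSpan σ δ b d := by
  induction m using FreeMonoid.inductionOn' with
  | one => exact h (opWord_mem_wordSpan (by simp))
  | of_mul i m ih => exact h (opD_mem_wordSpan ih i)

/-- `evalOn_surjective` transported to an indexed family, with no degree bound yet; injectivity
makes the choice of a preimage of each point harmless. -/
theorem exists_eval_eq [Finite ι] (hinj : Function.Injective b)
    (hind : PIndependent σ δ (Set.range b)) (v : ι → F) :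
    ∃ P : SkewPoly σ δ, ∀ p, eval P (b p) = v p := by
  classical
  have hA : ((Set.finite_range b).toFinset : Set (Fin n → F)) = Set.range b := by simp
  rw [← hA] at hind
  obtain ⟨P, hP⟩ := evalOn_surjective hind fun x =>
    v (Classical.choose (hA.subset x.2))
  refine ⟨P, fun p => ?_⟩
  have h := congrFun hP ⟨b p, hA.superset ⟨p, rfl⟩⟩
  refine h.trans (congrArg v (hinj ?_))
  exact Classical.choose_spec (hA.subset (hA.superset ⟨p, rfl⟩))

theorem mem_wordSpan_of_succ_le [Finite ι] (hinj : Function.Injective b)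
    (hind : PIndependent σ δ (Set.range b)) {d : ℕ}
    (h : wordSpan σ δ b (d + 1) ≤ wordSpan σ δ b d) : wordSpan σ δ b d = ⊤ := by
  refine eq_top_iff.mpr fun v _ => ?_
  obtain ⟨P, hP⟩ := exists_eval_eq hinj hind v
  have e : v = ∑ m ∈ P.support, P.coeff m • fun p => opWord σ δ (b p) m 1 := by
    funext p
    rw [← hP, eval_eq_linEval_one, linEval, lsum]
    simp
  rw [e]
  exact Submodule.sum_mem _ fun m _ =>
    Submodule.smul_mem _ _ (opWord_mem_of_wordSpan_succ_le h m)

/-- Interpolation by skew polynomials of degree less than the number of points. -/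
theorem exists_degree_lt_eval_eq [Fintype ι] (hinj : Function.Injective b)
    (hind : PIndependent σ δ (Set.range b)) (v : ι → F) :
    ∃ P : SkewPoly σ δ, P.degree < (Fintype.card ι : WithBot ℕ) ∧ ∀ p, eval P (b p) = v p := by
  -- Each step either stalls, and then the span is already everything, or gains at least one
  -- dimension.
  have key : ∀ d, wordSpan σ δ b d = ⊤ ∨ d ≤ Module.finrank F (wordSpan σ δ b d) := by
    intro d
    induction d with
    | zero => exact Or.inr (Nat.zero_le _)
    | succ d ih =>
      by_cases h : wordSpan σ δ b (d + 1) ≤ wordSpan σ δ b d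
      · left
        rw [eq_top_iff, ← mem_wordSpan_of_succ_le hinj hind h]
        exact wordSpan_mono d.le_succ
      · rcases ih with ih | ih
        · exact absurd (ih ▸ le_top) h
        · right
          have hlt := Submodule.finrank_lt_finrank_of_lt
            (lt_of_le_not_ge (wordSpan_mono (σ := σ) (δ := δ) (b := b) d.le_succ) h)
          exact Nat.succ_le_of_lt (ih.trans_lt hlt)
  have htop : wordSpan σ δ b (Fintype.card ι) = ⊤ := by
    rcases key (Fintype.card ι) with h | h
    · exact h
    · refine Submodule.eq_top_of_finrank_eq (le_antisymm (Submodule.finrank_le _) ?_)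
      rwa [Module.finrank_fintype_fun_eq_card]
  exact exists_of_mem_wordSpan (htop ▸ Submodule.mem_top)

end Interpolation

end SkewPoly

/-! ### Points of the P-closure and their exponents. -/

section Conjugacy

open SkewPoly

variable {F : Type*} [DivisionRing F] {n : ℕ}
  {σ : F →+* Matrix (Fin n) (Fin n) F} {δ : SkewDerivation σ}

theorem conjugate_eq_of_conjugate_eq {a c' : Fin n → F} {β γ : F} (hβ : β ≠ 0) (hγ : γ ≠ 0)
    (h : conjugate σ δ a β = conjugate σ δ c' γ) : c' = conjugate σ δ a (γ⁻¹ * β) := by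
  rw [conjugate_mul a hβ, h]
  exact (conjugate_inv_of_eq hγ rfl).symm

theorem subset_pClosure (Ω : Set (Fin n → F)) : Ω ⊆ pClosure σ δ Ω :=
  fun _ ha _ hP => hP _ ha

theorem pClosure_subset_of_subset {Ω Ω' : Set (Fin n → F)} (h : Ω' ⊆ pClosure σ δ Ω) :
    pClosure σ δ Ω' ⊆ pClosure σ δ Ω :=
  fun _ hc P hP => hc P fun _ hx => h hx P hP

variable {ℓ : ℕ} {M : Fin ℓ → ℕ} {a : Fin ℓ → Fin n → F} {β : (i : Fin ℓ) → Fin (M i) → F}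
  {b : (Σ i : Fin ℓ, Fin (M i)) → Fin n → F}

/-- The right span over the centralizer of `a i` of the exponents in the class of `a i`. -/
noncomputable def exponentSpan (σ : F →+* Matrix (Fin n) (Fin n) F) (δ : SkewDerivation σ)
    (a : Fin ℓ → Fin n → F) (β : (i : Fin ℓ) → Fin (M i) → F) (i : Fin ℓ) :
    Submodule (↥(centralizerAt σ δ (a i)))ᵐᵒᵖ F :=
  Submodule.span _ (Set.range (β i))

theorem linEval_eq_of_eqOn {i : Fin ℓ} (P : SkewPoly σ δ)
    (L : F →ₗ[(↥(centralizerAt σ δ (a i)))ᵐᵒᵖ] F)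
    (h : ∀ j, linEval P (a i) (β i j) = L (β i j)) {γ : F}
    (hγ : γ ∈ exponentSpan σ δ a β i) : linEval P (a i) γ = L γ := by
  have : Set.EqOn (linEvalHom P (a i)) L (Set.range (β i)) := by
    rintro _ ⟨j, rfl⟩
    exact h j
  exact LinearMap.eqOn_span this hγ

/-- If P vanishes at the points b, its linearized evaluation kills each β^{(i)}_j, hence by right
linearity their whole span. -/
theorem conjugate_mem_pClosure (hβ : ∀ i j, β i j ≠ 0)
    (hb : ∀ i j, b ⟨i, j⟩ = conjugate σ δ (a i) (β i j)) {i : Fin ℓ} {γ : F}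
    (hγ : γ ∈ exponentSpan σ δ a β i) (h0 : γ ≠ 0) :
    conjugate σ δ (a i) γ ∈ pClosure σ δ (Set.range b) := by
  intro P hP
  rw [eval_conjugate_eq_zero_iff P _ h0]
  refine linEval_eq_of_eqOn P 0 (fun j => ?_) hγ
  rw [LinearMap.zero_apply, ← eval_conjugate_eq_zero_iff P _ (hβ i j), ← hb]
  exact hP _ ⟨_, rfl⟩

/-- Every point of the P-closure of a P-independent set is a conjugate with exponent in one of the
spans of the exponents. -/
theorem exists_exponent_of_mem_pClosure
    (ha : Pairwise fun i k => ¬ IsConjugate σ δ (a i) (a k)) (hβ : ∀ i j, β i j ≠ 0)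
    (hb : ∀ i j, b ⟨i, j⟩ = conjugate σ δ (a i) (β i j))
    (hinj : Function.Injective b) (hind : PIndependent σ δ (Set.range b))
    {c : Fin n → F} (hc : c ∈ pClosure σ δ (Set.range b)) :
    ∃ i, ∃ γ ∈ exponentSpan σ δ a β i, γ ≠ 0 ∧ c = conjugate σ δ (a i) γ := by
  classical
  choose D hD using fun p : (Σ i : Fin ℓ, Fin (M i)) =>
    exists_eval_eq hinj hind (Pi.single p (1 : F))
  set ψ := fun p => eval (D p) c with hψ
  -- Evaluation at c depends only on the values at the points b, so it is a combination of them
  -- whose coefficients are the values at c of the dual polynomials `D p`.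
  have hsum : ∀ P : SkewPoly σ δ, eval P c = ∑ p, eval P (b p) * ψ p := by
    intro P
    have hv : P - ∑ p, eval P (b p) • D p ∈ vanishing σ δ (Set.range b) := by
      rintro _ ⟨q, rfl⟩
      -- Evaluation at one point is read as a coordinate of `evalOn` over all points, to use its
      -- linearity.
      change evalOn σ δ Set.univ (P - ∑ p, eval P (b p) • D p) ⟨b q, trivial⟩ = 0
      rw [map_sub, map_sum, Pi.sub_apply, Finset.sum_apply]
      simp only [map_smul, Pi.smul_apply, smul_eq_mul]
      have h1 : ∀ Q : SkewPoly σ δ, evalOn σ δ Set.univ Q ⟨b q, trivial⟩ = eval Q (b q) :=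
        fun _ => rfl
      simp [h1, hD, Pi.single_apply]
    have h := hc _ hv
    change evalOn σ δ Set.univ (P - ∑ p, eval P (b p) • D p) ⟨c, trivial⟩ = 0 at h
    rw [map_sub, map_sum, Pi.sub_apply, Finset.sum_apply] at h
    simp only [map_smul, Pi.smul_apply, smul_eq_mul] at h
    exact sub_eq_zero.mp h
  have hone : ∑ p, ψ p = 1 := by
    have h := hsum 1
    simp only [eval_one, one_mul] at h
    exact h.symm
  -- Apply `hsum` to x_i `D p`: only the term at p survives, leaving D_c(ψ_p) = b_p ψ_p.
  have hconj : ∀ p, ψ p ≠ 0 → conjugate σ δ c (ψ p) = b p := by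
    intro p hp
    rw [← opD_eq_iff_conjugate_eq hp]
    funext i
    have h := hsum (X i * D p)
    rw [eval_X_mul, Finset.sum_eq_single p] at h
    · rwa [eval_X_mul, hD, Pi.single_eq_same, opD_one] at h
    · intro q _ hq
      rw [eval_X_mul, hD, Pi.single_eq_of_ne hq, opD_zero, zero_mul]
    · simp
  obtain ⟨⟨i, j⟩, hij⟩ : ∃ p, ψ p ≠ 0 := by
    by_contra! h
    simp [h] at hone
  have hγ0 : (ψ ⟨i, j⟩)⁻¹ * β i j ≠ 0 := mul_ne_zero (inv_ne_zero hij) (hβ i j)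
  have hcγ : c = conjugate σ δ (a i) ((ψ ⟨i, j⟩)⁻¹ * β i j) :=
    conjugate_eq_of_conjugate_eq (hβ i j) hij (by rw [← hb, hconj _ hij])
  generalize (ψ ⟨i, j⟩)⁻¹ * β i j = γ at hγ0 hcγ
  refine ⟨i, γ, ?_, hγ0, hcγ⟩
  -- Write γ = ∑ ψ_p γ. Each nonzero term is an exponent carrying a_i to b_p, so p lies in class i
  -- and the term is in β_p K_{a_i}.
  rw [← one_mul γ, ← hone, Finset.sum_mul]
  refine Submodule.sum_mem _ fun p _ => ?_
  rcases eq_or_ne (ψ p) 0 with h0 | h0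
  · rw [h0, zero_mul]
    exact zero_mem _
  obtain ⟨k, j'⟩ := p
  have h1 : conjugate σ δ (a i) (ψ ⟨k, j'⟩ * γ) = conjugate σ δ (a k) (β k j') := by
    rw [conjugate_mul _ hγ0, ← hcγ, hconj _ h0, hb]
  have hne := mul_ne_zero h0 hγ0
  obtain rfl : i = k := by
    by_contra hik
    exact ha hik ⟨_, mul_ne_zero (inv_ne_zero (hβ k j')) hne,
      conjugate_eq_of_conjugate_eq hne (hβ k j') h1⟩
  have h2 : ψ ⟨i, j'⟩ * γ = β i j' * ((β i j')⁻¹ * (ψ ⟨i, j'⟩ * γ)) := by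
    rw [mul_inv_cancel_left₀ (hβ i j')]
  rw [h2]
  exact Submodule.smul_mem _
    (MulOpposite.op (⟨_, inv_mul_mem_centralizerAt (hβ i j') hne h1⟩ : centralizerAt σ δ (a i)))
    (Submodule.subset_span ⟨j', rfl⟩)

/-- Right linear maps on the spans of the exponents are realized by skew polynomials. -/
theorem exists_linEval_eq (hβ : ∀ i j, β i j ≠ 0)
    (hb : ∀ i j, b ⟨i, j⟩ = conjugate σ δ (a i) (β i j))
    (hinj : Function.Injective b) (hind : PIndependent σ δ (Set.range b))
    (L : (i : Fin ℓ) → F →ₗ[(↥(centralizerAt σ δ (a i)))ᵐᵒᵖ] F) :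
    ∃ P : SkewPoly σ δ, ∀ i, ∀ γ ∈ exponentSpan σ δ a β i, linEval P (a i) γ = L i γ := by
  -- The factor β⁻¹ cancels the β in the bridge formula, so P^{D_{a_i}} agrees with `L i` on the
  -- spanning exponents.
  obtain ⟨P, hP⟩ := exists_eval_eq hinj hind fun p => L p.1 (β p.1 p.2) * (β p.1 p.2)⁻¹
  refine ⟨P, fun i γ hγ => linEval_eq_of_eqOn P (L i) (fun j => ?_) hγ⟩
  rw [← eval_conjugate_mul P _ (hβ i j), ← hb, hP, inv_mul_cancel_right₀ (hβ i j)]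

/-- A polynomial dual to the point b^{(i)}_j has a linearized evaluation that fixes β^{(i)}_j and
kills the other exponents of the class; applied to a linear relation, it isolates the j-th
coefficient. -/
theorem linearIndependent_exponents (hβ : ∀ i j, β i j ≠ 0)
    (hb : ∀ i j, b ⟨i, j⟩ = conjugate σ δ (a i) (β i j))
    (hinj : Function.Injective b) (hind : PIndependent σ δ (Set.range b)) (i : Fin ℓ) :
    LinearIndependent (↥(centralizerAt σ δ (a i)))ᵐᵒᵖ (β i) := by
  classical
  rw [Fintype.linearIndependent_iff]
  intro g hg j
  obtain ⟨P, hP⟩ := exists_eval_eq hinj hind (Pi.single ⟨i, j⟩ (1 : F))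
  have hval : ∀ k, k ≠ j → linEvalHom P (a i) (β i k) = 0 := by
    intro k hk
    rw [linEvalHom_apply, ← eval_conjugate_mul P _ (hβ i k), ← hb, hP, Pi.single_eq_of_ne,
      zero_mul]
    intro h
    exact hk (by simpa using h)
  have hvj : linEvalHom P (a i) (β i j) = β i j := by
    rw [linEvalHom_apply, ← eval_conjugate_mul P _ (hβ i j), ← hb, hP, Pi.single_eq_same,
      one_mul]
  have h := congrArg (linEvalHom P (a i)) hg
  rw [map_sum, map_zero, Finset.sum_eq_single j] at h
  · rw [map_smul, hvj] at h
    exact (smul_eq_zero.mp h).resolve_right (hβ i j)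
  · intro k _ hk
    rw [map_smul, hval k hk, smul_zero]
  · simp

/-- Independent exponents in the spans give distinct and P-independent points. -/
theorem injective_and_pIndependent_conjugate (hβ : ∀ i j, β i j ≠ 0)
    (hb : ∀ i j, b ⟨i, j⟩ = conjugate σ δ (a i) (β i j))
    (hinj : Function.Injective b) (hind : PIndependent σ δ (Set.range b))
    {k : Fin ℓ → ℕ} (γ : (i : Fin ℓ) → Fin (k i) → F)
    (hγ : ∀ i j, γ i j ∈ exponentSpan σ δ a β i)
    (hli : ∀ i, LinearIndependent (↥(centralizerAt σ δ (a i)))ᵐᵒᵖ (γ i)) :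
    Function.Injective (fun p : (Σ i, Fin (k i)) => conjugate σ δ (a p.1) (γ p.1 p.2)) ∧
      PIndependent σ δ (Set.range
        fun p : (Σ i, Fin (k i)) => conjugate σ δ (a p.1) (γ p.1 p.2)) := by
  classical
  have h0 : ∀ i j, γ i j ≠ 0 := fun i j => (hli i).ne_zero j
  have hdual : ∀ p : (Σ i, Fin (k i)), ∃ P : SkewPoly σ δ, ∀ q : (Σ i, Fin (k i)),
      eval P (conjugate σ δ (a q.1) (γ q.1 q.2)) = 0 ↔ q ≠ p := by
    intro p
    -- The coordinate functional of γ_p on its span, and zero on the spans of the other classes,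
    -- each extended to F. The `ℕ` is only the scalar semiring over which `constr` is itself linear.
    choose L hL using fun i => LinearMap.exists_extend
      ((Module.Basis.span (hli i)).constr ℕ fun j =>
        if (⟨i, j⟩ : Σ i, Fin (k i)) = p then (1 : F) else 0)
    obtain ⟨P, hP⟩ := exists_linEval_eq hβ hb hinj hind L
    refine ⟨P, fun ⟨i, j⟩ => ?_⟩
    rw [eval_conjugate_eq_zero_iff P _ (h0 i j), hP i _ (hγ i j)]
    have h := DFunLike.congr_fun (hL i) (Module.Basis.span (hli i) j)
    rw [Module.Basis.constr_basis, LinearMap.comp_apply, Submodule.subtype_apply,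
      Module.Basis.span_apply] at h
    rw [h]
    simp
  constructor
  · intro p q hpq
    obtain ⟨P, hP⟩ := hdual p
    by_contra hne
    have h := (hP q).mpr (Ne.symm hne)
    change conjugate σ δ _ _ = conjugate σ δ _ _ at hpq
    rw [← hpq] at h
    exact (hP p).mp h rfl
  · rintro _ ⟨p, rfl⟩ hcl
    obtain ⟨P, hP⟩ := hdual p
    refine (hP p).mp (hcl P ?_) rfl
    rintro _ ⟨⟨q, rfl⟩, hq⟩
    refine (hP q).mpr ?_
    rintro rfl
    exact hq rfl

/-! ### Ranks of zero sets and the weight formula. -/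

theorem pRank_pClosure_range {ι : Type*} [Fintype ι] {b : ι → Fin n → F} {Ω : Set (Fin n → F)}
    (hinj : Function.Injective b) (h : IsPBasis σ δ (Set.range b) Ω) :
    pRank σ δ Ω = Fintype.card ι := by
  classical
  have e : ((Finset.univ.image b : Finset (Fin n → F)) : Set (Fin n → F)) = Set.range b := by
    simp
  rw [← e] at h
  rw [pRank_eq h, Finset.card_image_of_injective _ hinj, Finset.card_univ]

/-- The zeros in the P-closure of `b` of a skew polynomial have a P-basis that comes from bases of
the kernels of its linearized evaluations. -/
theorem isPBasis_zerosIn (ha : Pairwise fun i k => ¬ IsConjugate σ δ (a i) (a k))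
    (hβ : ∀ i j, β i j ≠ 0)
    (hb : ∀ i j, b ⟨i, j⟩ = conjugate σ δ (a i) (β i j))
    (hinj : Function.Injective b) (hind : PIndependent σ δ (Set.range b)) (P : SkewPoly σ δ)
    {k : Fin ℓ → ℕ} (γ : (i : Fin ℓ) → Fin (k i) → F)
    (hli : ∀ i, LinearIndependent (↥(centralizerAt σ δ (a i)))ᵐᵒᵖ (γ i))
    (hγ : ∀ i, Submodule.span (↥(centralizerAt σ δ (a i)))ᵐᵒᵖ (Set.range (γ i)) =
      exponentSpan σ δ a β i ⊓ LinearMap.ker (linEvalHom P (a i))) :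
    IsPBasis σ δ (Set.range fun p : (Σ i, Fin (k i)) => conjugate σ δ (a p.1) (γ p.1 p.2))
      (zerosIn σ δ (pClosure σ δ (Set.range b)) P) := by
  have h0 : ∀ i j, γ i j ≠ 0 := fun i j => (hli i).ne_zero j
  have hmem : ∀ i j, γ i j ∈ exponentSpan σ δ a β i ⊓ LinearMap.ker (linEvalHom P (a i)) :=
    fun i j => hγ i ▸ Submodule.subset_span ⟨j, rfl⟩
  have hsub : (Set.range fun p : (Σ i, Fin (k i)) => conjugate σ δ (a p.1) (γ p.1 p.2)) ⊆
      zerosIn σ δ (pClosure σ δ (Set.range b)) P := by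
    rintro _ ⟨⟨i, j⟩, rfl⟩
    exact ⟨conjugate_mem_pClosure hβ hb (hmem i j).1 (h0 i j),
      (eval_conjugate_eq_zero_iff P _ (h0 i j)).mpr (hmem i j).2⟩
  refine ⟨hsub, (injective_and_pIndependent_conjugate hβ hb hinj hind γ
    (fun i j => (hmem i j).1) hli).2, Set.Subset.antisymm ?_ ?_⟩
  · intro c hc
    exact ⟨pClosure_subset_of_subset (fun x hx => (hsub hx).1) hc, hc P fun x hx => (hsub hx).2⟩
  · rintro c ⟨hc, hPc⟩
    obtain ⟨i, η, hη, hη0, rfl⟩ := exists_exponent_of_mem_pClosure ha hβ hb hinj hind hc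
    -- The closure lemma is reused with the kernel bases γ as the exponents.
    refine conjugate_mem_pClosure (β := γ) (b := fun p => conjugate σ δ (a p.1) (γ p.1 p.2))
      h0 (fun _ _ => rfl) ?_ hη0
    rw [exponentSpan, hγ i]
    exact ⟨hη, (eval_conjugate_eq_zero_iff P _ hη0).mp hPc⟩

/-- Rank-nullity for L restricted to the span of v: the image is spanned by the vectors L(v_j), and
the span itself has dimension m. -/
theorem finrank_inf_ker_add_rankWeight {K : Subfield F} {m : ℕ} {v : Fin m → F}
    (hv : LinearIndependent (↥K)ᵐᵒᵖ v) (L : F →ₗ[(↥K)ᵐᵒᵖ] F) :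
    Module.finrank (↥K)ᵐᵒᵖ
        ↥(Submodule.span (↥K)ᵐᵒᵖ (Set.range v) ⊓ LinearMap.ker L) +
      rankWeight K (fun j => L (v j)) = m := by
  set W := Submodule.span (↥K)ᵐᵒᵖ (Set.range v) with hW
  have hfin : FiniteDimensional (↥K)ᵐᵒᵖ W :=
    FiniteDimensional.span_of_finite _ (Set.finite_range v)
  have h := LinearMap.finrank_range_add_finrank_ker (L.domRestrict W)
  rw [finrank_span_eq_card hv, Fintype.card_fin, LinearMap.range_domRestrict,
    LinearMap.ker_domRestrict, hW, Submodule.map_span, ← Set.range_comp] at h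
  rw [rankWeight, add_comm]
  refine Eq.trans ?_ h
  congr 1
  rw [inf_comm]
  -- The kernel of the restriction is a subspace of W; it is identified with the intersection taken
  -- inside F.
  exact ((Submodule.comapSubtypeEquivOfLe (p := LinearMap.ker L ⊓ W) (q := W)
    inf_le_right).finrank_eq).symm.trans
      (by rw [Submodule.comap_inf, Submodule.comap_subtype_self, inf_top_eq])

/-- Rank-nullity summed over the classes. It holds for P of any degree, as only the values of P at
the points b enter the right-hand side; this makes the weight independent of the interpolating
polynomial. -/
theorem exists_pBasis_and_skewWeightPoly_eq
    (ha : Pairwise fun i k => ¬ IsConjugate σ δ (a i) (a k)) (hβ : ∀ i j, β i j ≠ 0)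
    (hb : ∀ i j, b ⟨i, j⟩ = conjugate σ δ (a i) (β i j))
    (hinj : Function.Injective b) (hind : PIndependent σ δ (Set.range b)) (P : SkewPoly σ δ) :
    (∃ Z : Finset (Fin n → F), IsPBasis σ δ (Z : Set (Fin n → F))
      (zerosIn σ δ (pClosure σ δ (Set.range b)) P)) ∧
    skewWeightPoly σ δ (pClosure σ δ (Set.range b)) P =
      (sumRankWeight (fun i => centralizerAt σ δ (a i)) M
        (fun p => eval P (b p) * β p.1 p.2) : ℤ) := by
  classical
  have hli := linearIndependent_exponents hβ hb hinj hind
  let N := fun i => exponentSpan σ δ a β i ⊓ LinearMap.ker (linEvalHom P (a i))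
  have hW : ∀ i, FiniteDimensional (↥(centralizerAt σ δ (a i)))ᵐᵒᵖ (exponentSpan σ δ a β i) :=
    fun i => FiniteDimensional.span_of_finite _ (Set.finite_range (β i))
  have hN : ∀ i, FiniteDimensional (↥(centralizerAt σ δ (a i)))ᵐᵒᵖ (N i) :=
    fun i => Submodule.finiteDimensional_of_le inf_le_left
  let B := fun i => Module.finBasis (↥(centralizerAt σ δ (a i)))ᵐᵒᵖ (N i)
  let γ := fun i j => ((B i j : N i) : F)
  have hγli : ∀ i, LinearIndependent (↥(centralizerAt σ δ (a i)))ᵐᵒᵖ (γ i) := fun i =>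
    (B i).linearIndependent.map' (N i).subtype (Submodule.ker_subtype _)
  have hγspan : ∀ i, Submodule.span (↥(centralizerAt σ δ (a i)))ᵐᵒᵖ (Set.range (γ i)) = N i := by
    intro i
    have h := congrArg (Submodule.map (N i).subtype) (B i).span_eq
    rwa [Submodule.map_span, ← Set.range_comp, Submodule.map_top, Submodule.range_subtype] at h
  have hbasis := isPBasis_zerosIn ha hβ hb hinj hind P γ hγli hγspan
  have hγinj := (injective_and_pIndependent_conjugate hβ hb hinj hind γ
    (fun i j => (B i j).2.1) hγli).1
  refine ⟨⟨(Set.finite_range _).toFinset, by rwa [Set.Finite.coe_toFinset]⟩, ?_⟩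
  rw [skewWeightPoly, pRank_pClosure_range hγinj hbasis,
    pRank_pClosure_range hinj ⟨subset_pClosure _, hind, rfl⟩]
  simp only [Fintype.card_sigma, Fintype.card_fin, sumRankWeight, Nat.cast_sum]
  rw [← Finset.sum_sub_distrib]
  refine Finset.sum_congr rfl fun i _ => ?_
  have h := finrank_inf_ker_add_rankWeight (hli i) (linEvalHom P (a i))
  simp only [linEvalHom_apply, ← eval_conjugate_mul P _ (hβ i _), ← hb] at h
  exact sub_eq_of_eq_add' (by exact_mod_cast h.symm)

end Conjugacy

/-! ### The main theorem. -/

theorem mainTheorem12 {F : Type*} [DivisionRing F] {n : ℕ}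
    (σ : F →+* Matrix (Fin n) (Fin n) F) (δ : SkewDerivation σ)
    {ℓ : ℕ} (M : Fin ℓ → ℕ) (a : Fin ℓ → Fin n → F)
    (ha : Pairwise fun i k => ¬ IsConjugate σ δ (a i) (a k))
    (β : (i : Fin ℓ) → Fin (M i) → F) (hβ : ∀ i j, β i j ≠ 0)
    (b : (Σ i : Fin ℓ, Fin (M i)) → Fin n → F)
    (hb : ∀ i j, b ⟨i, j⟩ = conjugate σ δ (a i) (β i j))
    (hinj : Function.Injective b) (hind : PIndependent σ δ (Set.range b)) :
    (∀ f : Set.range b → F,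
      (∃ P : SkewPoly σ δ, Interpolates σ δ (Set.range b) f P) ∧
      (∀ P : SkewPoly σ δ, Interpolates σ δ (Set.range b) f P →
        (∃ Z : Finset (Fin n → F),
          IsPBasis σ δ (Z : Set (Fin n → F)) (zerosIn σ δ (pClosure σ δ (Set.range b)) P)) ∧
        skewWeightPoly σ δ (pClosure σ δ (Set.range b)) P =
          (sumRankWeight (fun i => centralizerAt σ δ (a i)) M
            (fun p => f ⟨b p, Set.mem_range_self p⟩ * β p.1 p.2) : ℤ)) ∧
      skewWeight σ δ (Set.range b) f =
        (sumRankWeight (fun i => centralizerAt σ δ (a i)) M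
          (fun p => f ⟨b p, Set.mem_range_self p⟩ * β p.1 p.2) : ℤ)) ∧
    (∀ d : ℕ, linRMCode σ δ d a β =
      (fun (c : (Σ i : Fin ℓ, Fin (M i)) → F) p => c p * β p.1 p.2) '' skewRMCode σ δ d b) := by
  have hval : ∀ f P, Interpolates σ δ (Set.range b) f P →
      ∀ p, SkewPoly.eval P (b p) = f ⟨b p, Set.mem_range_self p⟩ :=
    fun f P hP p => congrFun hP.2 ⟨b p, Set.mem_range_self p⟩
  refine ⟨fun f => ?_, fun d => ?_⟩
  · have hex : ∃ P : SkewPoly σ δ, Interpolates σ δ (Set.range b) f P := by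
      obtain ⟨P, hP, hPf⟩ := SkewPoly.exists_degree_lt_eval_eq hinj hind
        fun p => f ⟨b p, Set.mem_range_self p⟩
      refine ⟨P, ?_, ?_⟩
      · rwa [← Set.image_univ, Set.ncard_image_of_injective _ hinj, Set.ncard_univ,
          Nat.card_eq_fintype_card]
      · funext ⟨_, p, rfl⟩
        exact hPf p
    have hweight : ∀ P : SkewPoly σ δ, Interpolates σ δ (Set.range b) f P →
        (∃ Z : Finset (Fin n → F),
          IsPBasis σ δ (Z : Set (Fin n → F)) (zerosIn σ δ (pClosure σ δ (Set.range b)) P)) ∧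
        skewWeightPoly σ δ (pClosure σ δ (Set.range b)) P =
          (sumRankWeight (fun i => centralizerAt σ δ (a i)) M
            (fun p => f ⟨b p, Set.mem_range_self p⟩ * β p.1 p.2) : ℤ) := by
      intro P hP
      have h := exists_pBasis_and_skewWeightPoly_eq ha hβ hb hinj hind P
      simpa only [hval f P hP] using h
    refine ⟨hex, hweight, ?_⟩
    -- An interpolating polynomial exists, so the default value 0 is not used, and `hweight` covers
    -- whichever polynomial was chosen.
    rw [skewWeight, dif_pos hex]
    exact (hweight _ hex.choose_spec).2
  -- The same P, hence the same degree bound, serves both codes; the bridge formula is exactly the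
  -- scaling.
  · have hlin : ∀ (P : SkewPoly σ δ) (p : Σ i : Fin ℓ, Fin (M i)),
        SkewPoly.linEval P (a p.1) (β p.1 p.2) = SkewPoly.eval P (b p) * β p.1 p.2 := by
      rintro P ⟨i, j⟩
      rw [hb, SkewPoly.eval_conjugate_mul P _ (hβ i j)]
    ext c
    constructor
    · rintro ⟨P, hP, rfl⟩
      exact ⟨_, ⟨P, hP, rfl⟩, funext fun p => (hlin P p).symm⟩
    · rintro ⟨_, ⟨P, hP, rfl⟩, rfl⟩
      exact ⟨P, hP, funext fun p => (hlin P p).symm⟩
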